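/- Let $V$ be a nonempty finite set, $P=(P_{ij})_{i,j\in V}$ a row-stochastic matrix (irreducible or not), and $\lambda>0$. For a $V$-valued process $(X_t)_{t\ge 0}$ on a probability space, with natural filtration $\mathcal F_t=\sigma(X_0,\dots,X_t)$, define $$L_t(i)=\sum_{s=0}^{t-1}\mathbf 1\{X_s=i\},\qquad N_t(i,j)=\sum_{s=0}^{t-1}\mathbf 1\{X_s=i,\,X_{s+1}=j\},\qquad \epsilon_t(i,j)=N_t(i,j)-L_t(i)P_{ij}.$$ Assume that $(X_t)$ is the true self-avoiding walk driven by $P$, with arbitrary initial law: for all $t\ge 0$ and $j\in V$, almost surely $$\mathbb P(X_{t+1}=j\mid\mathcal F_t)=Q_t(X_t,j),\qquad Q_t(i,j)=\frac{P_{ij}\,e^{-\lambda\epsilon_t(i,j)}}{\sum_{k\in V}P_{ik}\,e^{-\lambda\epsilon_t(i,k)}}.$$ Let $\mathcal N(i)=\{j:P_{ij}>0\}$, $d_i=|\mathcal N(i)|$, $d_{\max}=\max_{i\in V}d_i$, and $M(t)=\max_{i\in V}\max_{j\in\mathcal N(i)}\epsilon_t(i,j)$. If $d_{\max}=1$, then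 almost surely $M(t)=0$ for all $t\ge 0$. Otherwise, let $p_{\min}=\min_{i:\,d_i\ge 2}\min_{j\in\mathcal N(i)}P_{ij}$, $$C_0=\log\Big(1+\frac{2}{p_{\min}}\Big),\qquad C_1=1-p_{\min}+\frac1\lambda\Big(\log d_{\max}+\lambda+\log 2+2\log\frac1{p_{\min}}\Big),$$ and, for $\delta>0$, $$\Lambda_t=\log\big(|V|\,(t+1)(t+2)^{1+\delta}\big),\qquad \alpha_t=\max\{1,\sqrt{\lambda\Lambda_t}\}.$$ Then, for every $\delta>0$, almost surely, for all sufficiently large $t$, $$M(t)\le C_1+2\sqrt{\frac{\Lambda_t}{\lambda}}+\frac{C_0}{\alpha_t}.$$ -/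

import Mathlib

open MeasureTheory ProbabilityTheory Filter

noncomputable section

namespace TSAW

variable {V : Type*} [Fintype V] [DecidableEq V]

/-- Departure count `L_t(i)`: number of times `s < t` with `x s = i`. -/
def departures (x : ℕ → V) (t : ℕ) (i : V) : ℕ :=
  ((Finset.range t).filter (fun s => x s = i)).card

/-- Directed edge count `N_t(i,j)`: number of times `s < t` with `x s = i` and `x (s+1) = j`. -/
def edgeCount (x : ℕ → V) (t : ℕ) (i j : V) : ℕ :=
  ((Finset.range t).filter (fun s => x s = i ∧ x (s + 1) = j)).card

/-- Edge discrepancy `ε_t(i,j) = N_t(i,j) - L_t(i) P_{ij}` of the trajectory `x`. -/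
def edgeDisc (P : Matrix V V ℝ) (x : ℕ → V) (t : ℕ) (i j : V) : ℝ :=
  (edgeCount x t i j : ℝ) - (departures x t i : ℝ) * P i j

/-- The adaptive transition matrix
`Q_t(i,j) = P_{ij} exp(-λ ε_t(i,j)) / ∑_k P_{ik} exp(-λ ε_t(i,k))`. -/
def adaptiveKernel (P : Matrix V V ℝ) (lam : ℝ) (x : ℕ → V) (t : ℕ) (i j : V) : ℝ :=
  P i j * Real.exp (-lam * edgeDisc P x t i j) /
    ∑ k, P i k * Real.exp (-lam * edgeDisc P x t i k)

/-- The natural sigma-algebra `F_t = σ(X_0, …, X_t)`. -/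
abbrev history {Ω : Type*} [MeasurableSpace V] (X : ℕ → Ω → V) (t : ℕ) : MeasurableSpace Ω :=
  ⨆ s : Fin (t + 1), MeasurableSpace.comap (X s) inferInstance

/-- `X` is a (lifted) true self-avoiding walk with base kernel `P` and repulsion `lam`, started from
an arbitrary initial law: given `F_t`, the next state is `j` with probability `Q_t(X_t, j)`. -/
structure IsTSAW {Ω : Type*} [MeasurableSpace Ω] [MeasurableSpace V] (μ : Measure Ω)
    (P : Matrix V V ℝ) (lam : ℝ) (X : ℕ → Ω → V) : Prop where
  measurable : ∀ t, Measurable (X t)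
  transition : ∀ (t : ℕ) (j : V),
    μ⟦X (t + 1) ⁻¹' {j} | history X t⟧ =ᵐ[μ]
      fun ω => adaptiveKernel P lam (fun s => X s ω) t (X t ω) j

/-- The maximal edge discrepancy `M(t)`, the maximum of `ε_t(i,j)` over the support edges
`P_{ij} > 0`. -/
def maxDisc (P : Matrix V V ℝ) (x : ℕ → V) (t : ℕ) : ℝ :=
  ⨆ e : {e : V × V // 0 < P e.1 e.2}, edgeDisc P x t e.1.1 e.1.2

/-- Out-degree `d_i = |{j : P_{ij} > 0}|`. -/
def outDegree (P : Matrix V V ℝ) (i : V) : ℕ := Nat.card {j : V // 0 < P i j}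

/-- `d_max = max_i d_i`. -/
def dMax (P : Matrix V V ℝ) : ℕ := Finset.univ.sup (outDegree P)

/-- `p_min`, the smallest positive entry of `P` in the rows with out-degree at least two. -/
def pMin (P : Matrix V V ℝ) : ℝ :=
  ⨅ e : {e : V × V // 2 ≤ outDegree P e.1 ∧ 0 < P e.1 e.2}, P e.1.1 e.1.2

/-- `C₀ = log (1 + 2 / p_min)`. -/
def C0 (P : Matrix V V ℝ) : ℝ := Real.log (1 + 2 / pMin P)

/-- `C₁ = 1 - p_min + (log d_max + λ + log 2 + 2 log (1 / p_min)) / λ`. -/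
def C1 (P : Matrix V V ℝ) (lam : ℝ) : ℝ :=
  1 - pMin P +
    1 / lam * (Real.log (dMax P) + lam + Real.log 2 + 2 * Real.log (1 / pMin P))

variable (V) in
/-- `Λ_t = log (|V| (t+1) (t+2)^(1+δ))`. -/
def bigLambda (δ : ℝ) (t : ℕ) : ℝ :=
  Real.log ((Fintype.card V : ℝ) * ((t : ℝ) + 1) * ((t : ℝ) + 2) ^ (1 + δ))

variable (V) in
/-- `α_t = max {1, √(λ Λ_t)}`. -/
def alpha (lam δ : ℝ) (t : ℕ) : ℝ := max 1 (Real.sqrt (lam * bigLambda V δ t))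

end TSAW

end

set_option linter.unusedSectionVars false

/-! Each edge `(i, j)` is handled separately, through the exponential moment of order `a ≥ 1` of its
discrepancy. The discrepancies out of `i` over the support have nonpositive sum, so one of them is
nonpositive and the denominator of `Q_t(i, ·)` is at least `pMin` when `d_i ≥ 2`. Hence `Q ≤ P
e^{-λε} / pMin`, and once `ε` exceeds `driftLevel = (a + log (1/pMin)) / λ` the transition is so
strongly suppressed that `e^{aε}` is a supermartingale step (`exp_drift_le_one`). Below that level a
step raises `ε` by at most `1 - P i j`, so the expectation of `e^{aε}` grows at most linearly in `t`
(`IsTSAW.integral_exp_edgeDisc_le`).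

Markov's inequality with `a = α_t` and deviation `Λ_t / α_t` bounds the exceedance probability by
`(t+2)^{-(1+δ)}`, and Borel–Cantelli applies to each of the finitely many edges. The choice `α_t =
√(λ Λ_t)` balances `α_t / λ` against `Λ_t / α_t`, which gives the term `2 √(Λ_t / λ)`. Rows of
out-degree one are deterministic and need no moment bound. -/

namespace TSAW

/-! ### Deterministic recursions and bounds for counts along a trajectory. -/

section Trajectory

variable {V : Type*} [DecidableEq V]

lemma departures_succ (x : ℕ → V) (t : ℕ) (i : V) :
    departures x (t + 1) i = departures x t i + if x t = i then 1 else 0 := by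
  unfold departures
  rw [Finset.card_filter, Finset.card_filter, Finset.sum_range_succ]

lemma edgeCount_succ (x : ℕ → V) (t : ℕ) (i j : V) :
    edgeCount x (t + 1) i j = edgeCount x t i j + if x t = i ∧ x (t + 1) = j then 1 else 0 := by
  unfold edgeCount
  rw [Finset.card_filter, Finset.card_filter, Finset.sum_range_succ]

lemma edgeCount_le_departures (x : ℕ → V) (t : ℕ) (i j : V) :
    edgeCount x t i j ≤ departures x t i :=
  Finset.card_le_card fun s hs => by
    rw [Finset.mem_filter] at hs ⊢
    exact ⟨hs.1, hs.2.1⟩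

lemma departures_le (x : ℕ → V) (t : ℕ) (i : V) : departures x t i ≤ t :=
  (Finset.card_filter_le _ _).trans_eq (Finset.card_range t)

lemma sum_edgeCount_le_departures (S : Finset V) (x : ℕ → V) (t : ℕ) (i : V) :
    ∑ j ∈ S, edgeCount x t i j ≤ departures x t i := by
  induction t with
  | zero => simp [edgeCount, departures]
  | succ t ih =>
    simp only [edgeCount_succ, departures_succ, Finset.sum_add_distrib]
    refine Nat.add_le_add ih ?_
    by_cases h : x t = i
    · simp only [h, true_and, if_true, Finset.sum_ite_eq]
      split_ifs <;> simp
    · simp [h]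

lemma edgeDisc_succ (P : Matrix V V ℝ) (x : ℕ → V) (t : ℕ) (i j : V) :
    edgeDisc P x (t + 1) i j = edgeDisc P x t i j +
      if x t = i then (if x (t + 1) = j then 1 else 0) - P i j else 0 := by
  unfold edgeDisc
  rw [departures_succ, edgeCount_succ]
  by_cases h : x t = i <;> by_cases h' : x (t + 1) = j <;> simp [h, h'] <;> ring

lemma edgeDisc_le (P : Matrix V V ℝ) (x : ℕ → V) (t : ℕ) (i j : V) (h : 0 ≤ P i j) :
    edgeDisc P x t i j ≤ t := by
  have h1 : (edgeCount x t i j : ℝ) ≤ t :=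
    by exact_mod_cast (edgeCount_le_departures x t i j).trans (departures_le x t i)
  have h2 : 0 ≤ (departures x t i : ℝ) * P i j := by positivity
  unfold edgeDisc
  linarith

end Trajectory

/-! ### Pointwise bounds on the adaptive kernel and the one-step drift. -/

section Kernel

variable {V : Type*} [Fintype V] [DecidableEq V] {P : Matrix V V ℝ}

lemma nonneg_of_rowStochastic (hP : P ∈ Matrix.rowStochastic ℝ V) (i j : V) : 0 ≤ P i j :=
  (Matrix.mem_rowStochastic_iff_sum.1 hP).1 i j

lemma row_sum_of_rowStochastic (hP : P ∈ Matrix.rowStochastic ℝ V) (i : V) : ∑ j, P i j = 1 :=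
  (Matrix.mem_rowStochastic_iff_sum.1 hP).2 i

lemma le_one_of_rowStochastic (hP : P ∈ Matrix.rowStochastic ℝ V) (i j : V) : P i j ≤ 1 := by
  rw [← row_sum_of_rowStochastic hP i]
  exact Finset.single_le_sum (fun k _ => nonneg_of_rowStochastic hP i k) (Finset.mem_univ j)

lemma exists_pos_of_rowStochastic (hP : P ∈ Matrix.rowStochastic ℝ V) (i : V) :
    ∃ j, 0 < P i j := by
  by_contra! h
  have := Finset.sum_nonpos fun j (_ : j ∈ Finset.univ) => h j
  linarith [row_sum_of_rowStochastic hP i]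

lemma outDegree_eq_card (P : Matrix V V ℝ) (i : V) :
    outDegree P i = (Finset.univ.filter fun j => 0 < P i j).card := by
  classical
  unfold outDegree
  rw [Nat.card_eq_fintype_card, Fintype.card_subtype]

lemma one_le_outDegree (hP : P ∈ Matrix.rowStochastic ℝ V) (i : V) : 1 ≤ outDegree P i := by
  obtain ⟨j, hj⟩ := exists_pos_of_rowStochastic hP i
  rw [outDegree_eq_card]
  exact Finset.card_pos.2 ⟨j, by simpa using hj⟩

lemma eq_zero_of_outDegree_le_one (hP : P ∈ Matrix.rowStochastic ℝ V) {i j k : V}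
    (hd : outDegree P i ≤ 1) (hj : 0 < P i j) (hk : k ≠ j) : P i k = 0 := by
  rw [outDegree_eq_card, Finset.card_le_one] at hd
  by_contra h
  exact hk (hd k (by simpa using lt_of_le_of_ne (nonneg_of_rowStochastic hP i k) (Ne.symm h))
    j (by simpa using hj))

lemma eq_one_of_outDegree_le_one (hP : P ∈ Matrix.rowStochastic ℝ V) {i j : V}
    (hd : outDegree P i ≤ 1) (hj : 0 < P i j) : P i j = 1 := by
  rw [← row_sum_of_rowStochastic hP i]
  exact (Finset.sum_eq_single j
    (fun k _ hk => eq_zero_of_outDegree_le_one hP hd hj hk) (by simp)).symm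

lemma pMin_le {i j : V} (hd : 2 ≤ outDegree P i) (hj : 0 < P i j) : pMin P ≤ P i j :=
  ciInf_le (Set.finite_range _).bddBelow
    (⟨(i, j), hd, hj⟩ : {e : V × V // 2 ≤ outDegree P e.1 ∧ 0 < P e.1 e.2})

/-- The edge `(i, j)` makes the index type nonempty; a real infimum over an empty type would be `0`.
-/
lemma pMin_pos {i j : V} (hd : 2 ≤ outDegree P i) (hj : 0 < P i j) : 0 < pMin P := by
  have : Nonempty {e : V × V // 2 ≤ outDegree P e.1 ∧ 0 < P e.1 e.2} := ⟨⟨(i, j), hd, hj⟩⟩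
  obtain ⟨e, he⟩ := exists_eq_ciInf_of_finite
    (f := fun e : {e : V × V // 2 ≤ outDegree P e.1 ∧ 0 < P e.1 e.2} => P e.1.1 e.1.2)
  rw [pMin, ← he]
  exact e.2.2

lemma sum_weights_pos (hP : P ∈ Matrix.rowStochastic ℝ V) (lam : ℝ) (x : ℕ → V) (t : ℕ) (i : V) :
    0 < ∑ k, P i k * Real.exp (-lam * edgeDisc P x t i k) := by
  obtain ⟨j, hj⟩ := exists_pos_of_rowStochastic hP i
  exact Finset.sum_pos' (fun k _ => mul_nonneg (nonneg_of_rowStochastic hP i k) (Real.exp_nonneg _))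
    ⟨j, Finset.mem_univ j, mul_pos hj (Real.exp_pos _)⟩

lemma adaptiveKernel_nonneg (hP : P ∈ Matrix.rowStochastic ℝ V) (lam : ℝ) (x : ℕ → V) (t : ℕ)
    (i j : V) : 0 ≤ adaptiveKernel P lam x t i j :=
  div_nonneg (mul_nonneg (nonneg_of_rowStochastic hP i j) (Real.exp_nonneg _))
    (sum_weights_pos hP lam x t i).le

lemma adaptiveKernel_le_one (hP : P ∈ Matrix.rowStochastic ℝ V) (lam : ℝ) (x : ℕ → V) (t : ℕ)
    (i j : V) : adaptiveKernel P lam x t i j ≤ 1 := by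
  unfold adaptiveKernel
  rw [div_le_one (sum_weights_pos hP lam x t i)]
  exact Finset.single_le_sum
    (f := fun k => P i k * Real.exp (-lam * edgeDisc P x t i k))
    (fun k _ => mul_nonneg (nonneg_of_rowStochastic hP i k) (Real.exp_nonneg _))
    (Finset.mem_univ j)

/-- Some support edge at each vertex has nonpositive discrepancy. -/
lemma exists_edgeDisc_nonpos (hP : P ∈ Matrix.rowStochastic ℝ V) (x : ℕ → V) (t : ℕ) (i : V) :
    ∃ k, 0 < P i k ∧ edgeDisc P x t i k ≤ 0 := by
  by_contra! h
  obtain ⟨j, hj⟩ := exists_pos_of_rowStochastic hP i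
  set S := Finset.univ.filter fun k => 0 < P i k
  have hS : ∑ k ∈ S, P i k = 1 := by
    rw [← row_sum_of_rowStochastic hP i]
    refine Finset.sum_subset (Finset.subset_univ _) fun k _ hk => ?_
    refine le_antisymm ?_ (nonneg_of_rowStochastic hP i k)
    simpa [S] using hk
  have hpos : 0 < ∑ k ∈ S, edgeDisc P x t i k :=
    Finset.sum_pos (fun k hk => h k (by simpa [S] using hk)) ⟨j, by simpa [S] using hj⟩
  -- Only an inequality holds: an arbitrary trajectory may also leave `i` along edges outside the
  -- support.
  have hle : (∑ k ∈ S, (edgeCount x t i k : ℝ)) ≤ departures x t i := by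
    exact_mod_cast sum_edgeCount_le_departures S x t i
  simp only [edgeDisc, Finset.sum_sub_distrib, ← Finset.mul_sum, hS] at hpos
  linarith

lemma adaptiveKernel_le (hP : P ∈ Matrix.rowStochastic ℝ V) {lam : ℝ} (hlam : 0 < lam)
    (x : ℕ → V) (t : ℕ) {i : V} (j : V) (hd : 2 ≤ outDegree P i) :
    adaptiveKernel P lam x t i j ≤ P i j * Real.exp (-lam * edgeDisc P x t i j) / pMin P := by
  obtain ⟨k, hk, hek⟩ := exists_edgeDisc_nonpos hP x t i
  refine div_le_div_of_nonneg_left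
    (mul_nonneg (nonneg_of_rowStochastic hP i j) (Real.exp_nonneg _)) (pMin_pos hd hk) ?_
  calc pMin P ≤ P i k * 1 := by rw [mul_one]; exact pMin_le hd hk
    _ ≤ P i k * Real.exp (-lam * edgeDisc P x t i k) := by
        gcongr
        exact Real.one_le_exp (by nlinarith)
    _ ≤ _ := Finset.single_le_sum
        (f := fun k => P i k * Real.exp (-lam * edgeDisc P x t i k))
        (fun k _ => mul_nonneg (nonneg_of_rowStochastic hP i k) (Real.exp_nonneg _))
        (Finset.mem_univ k)

/-- Above this level, the exponential moment of order `a` of a discrepancy has downward drift. -/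
noncomputable def driftLevel (P : Matrix V V ℝ) (lam a : ℝ) : ℝ := (a + Real.log (1 / pMin P)) / lam

/-- The left side is the conditional growth factor of `e^{aε}` on a departure from `i`. Above the
drift level `Q ≤ P e^{-a}`, so the gain `(e^a - 1) Q` is at most `P ≤ aP`; this is where `a ≥ 1`
enters. -/
lemma exp_drift_le_one (hP : P ∈ Matrix.rowStochastic ℝ V) {lam a : ℝ} (hlam : 0 < lam)
    (ha : 1 ≤ a) (x : ℕ → V) (t : ℕ) {i j : V} (hd : 2 ≤ outDegree P i) (hj : 0 < P i j)
    (hb : driftLevel P lam a ≤ edgeDisc P x t i j) :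
    Real.exp (-a * P i j) * (1 + (Real.exp a - 1) * adaptiveKernel P lam x t i j) ≤ 1 := by
  have hp := pMin_pos hd hj
  have hexp : Real.exp (-lam * edgeDisc P x t i j) ≤ Real.exp (-a) * pMin P := by
    rw [driftLevel, div_le_iff₀ hlam] at hb
    calc Real.exp (-lam * edgeDisc P x t i j)
        ≤ Real.exp (-a - Real.log (1 / pMin P)) := Real.exp_le_exp.2 (by linarith)
      _ = _ := by
        rw [one_div, Real.log_inv, sub_neg_eq_add, Real.exp_add, Real.exp_log hp]
  have hQ : adaptiveKernel P lam x t i j ≤ P i j * Real.exp (-a) := by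
    refine (adaptiveKernel_le hP hlam x t j hd).trans ?_
    rw [div_le_iff₀ hp, mul_assoc]
    exact mul_le_mul_of_nonneg_left hexp hj.le
  have hQ0 := adaptiveKernel_nonneg hP lam x t i j
  have h1 : (Real.exp a - 1) * adaptiveKernel P lam x t i j ≤ a * P i j := by
    calc (Real.exp a - 1) * adaptiveKernel P lam x t i j
        ≤ Real.exp a * (P i j * Real.exp (-a)) := by
          refine mul_le_mul (by linarith) hQ hQ0 (Real.exp_nonneg _)
      _ = P i j * (Real.exp a * Real.exp (-a)) := by ring
      _ = P i j := by rw [← Real.exp_add]; simp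
      _ ≤ a * P i j := le_mul_of_one_le_left hj.le ha
  calc Real.exp (-a * P i j) * (1 + (Real.exp a - 1) * adaptiveKernel P lam x t i j)
      ≤ Real.exp (-a * P i j) * Real.exp (a * P i j) := by
        gcongr
        linarith [Real.add_one_le_exp (a * P i j)]
    _ = 1 := by rw [← Real.exp_add]; simp

lemma exp_drift_le (hP : P ∈ Matrix.rowStochastic ℝ V) {lam a : ℝ} (hlam : 0 < lam)
    (ha : 1 ≤ a) (x : ℕ → V) (t : ℕ) {i j : V} (hd : 2 ≤ outDegree P i) (hj : 0 < P i j) :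
    Real.exp (a * edgeDisc P x t i j) *
        (Real.exp (-a * P i j) * (1 + (Real.exp a - 1) * adaptiveKernel P lam x t i j)) ≤
      Real.exp (a * edgeDisc P x t i j) + Real.exp (a * (driftLevel P lam a + 1 - P i j)) := by
  rcases le_total (driftLevel P lam a) (edgeDisc P x t i j) with hb | hb
  · have := mul_le_mul_of_nonneg_left (exp_drift_le_one hP hlam ha x t hd hj hb)
      (Real.exp_nonneg (a * edgeDisc P x t i j))
    linarith [Real.exp_pos (a * (driftLevel P lam a + 1 - P i j))]
  -- Below the level, the crude bound `Q ≤ 1` suffices: the new value is at most that of a jump from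
  -- the level itself.
  · have hQ := adaptiveKernel_le_one hP lam x t i j
    have he : 0 ≤ Real.exp a - 1 := sub_nonneg.2 (Real.one_le_exp (by linarith))
    calc _ ≤ Real.exp (a * driftLevel P lam a) * (Real.exp (-a * P i j) * Real.exp a) := by
          have hQ0 := adaptiveKernel_nonneg hP lam x t i j
          gcongr
          nlinarith
      _ = Real.exp (a * (driftLevel P lam a + 1 - P i j)) := by
          rw [← Real.exp_add, ← Real.exp_add]; ring_nf
      _ ≤ _ := le_add_of_nonneg_left (Real.exp_nonneg _)

end Kernel

/-! ### Measurability, exponential moments and tail bounds for the walk. -/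

section Walk

variable {V : Type*} [Fintype V] [DecidableEq V] [MeasurableSpace V] [MeasurableSingletonClass V]
  {Ω : Type*} [mΩ : MeasurableSpace Ω] {μ : Measure Ω} {P : Matrix V V ℝ} {lam : ℝ}
  {X : ℕ → Ω → V}

lemma history_le {X : ℕ → Ω → V} (hX : ∀ t, Measurable (X t)) (t : ℕ) : history X t ≤ mΩ :=
  iSup_le fun s => (hX s).comap_le

lemma measurable_history (X : ℕ → Ω → V) {s t : ℕ} (h : s ≤ t) : Measurable[history X t] (X s) :=
  measurable_iff_comap_le.2 <| le_iSup
    (fun s : Fin (t + 1) => MeasurableSpace.comap (X s) inferInstance) ⟨s, Nat.lt_succ_of_le h⟩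

lemma measurableSet_history_eq (X : ℕ → Ω → V) {s t : ℕ} (h : s ≤ t) (i : V) :
    MeasurableSet[history X t] {ω | X s ω = i} :=
  measurable_history X h (measurableSet_singleton i)

lemma measurable_edgeDisc (P : Matrix V V ℝ) (X : ℕ → Ω → V) (t : ℕ) (i j : V) :
    Measurable[history X t] fun ω => edgeDisc P (fun s => X s ω) t i j := by
  let _ : MeasurableSpace Ω := history X t
  unfold edgeDisc edgeCount departures
  simp only [Finset.card_filter, Nat.cast_sum, Nat.cast_ite, Nat.cast_one, Nat.cast_zero]
  refine Measurable.sub (Finset.measurable_sum _ fun s hs => ?_)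
    ((Finset.measurable_sum _ fun s hs => ?_).mul_const _)
  · have hs' := Finset.mem_range.1 hs
    exact Measurable.ite ((measurableSet_history_eq X hs'.le i).inter
      (measurableSet_history_eq X (Nat.succ_le_of_lt hs') j)) measurable_const measurable_const
  · have hs' := Finset.mem_range.1 hs
    exact Measurable.ite (measurableSet_history_eq X hs'.le i) measurable_const measurable_const

lemma measurable_adaptiveKernel (P : Matrix V V ℝ) (lam : ℝ) (X : ℕ → Ω → V) (t : ℕ) (i j : V) :
    Measurable[history X t] fun ω => adaptiveKernel P lam (fun s => X s ω) t i j := by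
  let _ : MeasurableSpace Ω := history X t
  unfold adaptiveKernel
  have h (k : V) := measurable_edgeDisc P X t i k
  exact (((h j).const_mul _).exp.const_mul _).div
    (Finset.measurable_sum _ fun k _ => ((h k).const_mul _).exp.const_mul _)

variable [IsProbabilityMeasure μ]

/-- Integrating a bounded function of the past against a transition out of `i`. -/
lemma IsTSAW.integral_transition (hX : IsTSAW μ P lam X) (t : ℕ) (i j : V) {G : Ω → ℝ}
    (hG : Measurable[history X t] G) {C : ℝ} (hC : ∀ ω, ‖G ω‖ ≤ C)
    (hGi : ∀ ω, X t ω ≠ i → G ω = 0) :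
    ∫ ω, G ω * (if X (t + 1) ω = j then 1 else 0) ∂μ =
      ∫ ω, G ω * adaptiveKernel P lam (fun s => X s ω) t i j ∂μ := by
  have hm := history_le hX.measurable t
  have hGm : StronglyMeasurable[history X t] G := hG.stronglyMeasurable
  have hs : MeasurableSet (X (t + 1) ⁻¹' {j}) := hX.measurable _ (measurableSet_singleton j)
  have hint : Integrable ((X (t + 1) ⁻¹' {j}).indicator fun _ => (1 : ℝ)) μ :=
    (integrable_const 1).indicator hs
  have hprod : Integrable (G * (X (t + 1) ⁻¹' {j}).indicator fun _ => (1 : ℝ)) μ :=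
    hint.bdd_mul (hGm.mono hm).aestronglyMeasurable (Eventually.of_forall hC)
  have hpull := condExp_mul_of_stronglyMeasurable_left hGm hprod hint
  calc ∫ ω, G ω * (if X (t + 1) ω = j then 1 else 0) ∂μ
      = ∫ ω, (G * (X (t + 1) ⁻¹' {j}).indicator fun _ => (1 : ℝ)) ω ∂μ := by
        refine integral_congr_ae (Eventually.of_forall fun ω => ?_)
        by_cases h : X (t + 1) ω = j <;> simp [h]
    _ = ∫ ω, (μ[G * (X (t + 1) ⁻¹' {j}).indicator fun _ => (1 : ℝ) | history X t]) ω ∂μ :=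
        (integral_condExp hm).symm
    _ = _ := by
        refine integral_congr_ae ?_
        filter_upwards [hpull, hX.transition t j] with ω h1 h2
        rw [h1, Pi.mul_apply, h2]
        -- Since `G` vanishes off `{X t = i}`, the random row `X t ω` may be replaced by `i`.
        by_cases h : X t ω = i
        · rw [h]
        · simp [hGi ω h]

lemma integrable_exp_edgeDisc (hP : P ∈ Matrix.rowStochastic ℝ V) (hX : ∀ t, Measurable (X t))
    {a : ℝ} (ha : 0 ≤ a) (t : ℕ) (i j : V) :
    Integrable (fun ω => Real.exp (a * edgeDisc P (fun s => X s ω) t i j)) μ := by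
  refine Integrable.of_bound (C := Real.exp (a * t)) ?_ (Eventually.of_forall fun ω => ?_)
  · exact ((((measurable_edgeDisc P X t i j).mono (history_le hX t) le_rfl).const_mul
      a).exp).aestronglyMeasurable
  · rw [Real.norm_eq_abs, Real.abs_exp]
    gcongr
    exact edgeDisc_le P _ t i j (nonneg_of_rowStochastic hP i j)

lemma IsTSAW.integral_exp_edgeDisc_succ_le (hP : P ∈ Matrix.rowStochastic ℝ V) (hlam : 0 < lam)
    (hX : IsTSAW μ P lam X) {a : ℝ} (ha : 1 ≤ a) (t : ℕ) {i j : V}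
    (hd : 2 ≤ outDegree P i) (hj : 0 < P i j) :
    ∫ ω, Real.exp (a * edgeDisc P (fun s => X s ω) (t + 1) i j) ∂μ ≤
      ∫ ω, Real.exp (a * edgeDisc P (fun s => X s ω) t i j) ∂μ +
        Real.exp (a * (driftLevel P lam a + 1 - P i j)) := by
  have ha0 : 0 ≤ a := by linarith
  have hm := history_le hX.measurable t
  set Y : Ω → ℝ := fun ω => Real.exp (a * edgeDisc P (fun s => X s ω) t i j) with hY
  have hYm : Measurable[history X t] Y := ((measurable_edgeDisc P X t i j).const_mul a).exp
  have hYint : Integrable Y μ := integrable_exp_edgeDisc hP hX.measurable ha0 t i j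
  have hi : MeasurableSet[history X t] {ω | X t ω = i} := measurableSet_history_eq X le_rfl i
  set c := Real.exp (-a * P i j)
  have hc0 : 0 ≤ c := Real.exp_nonneg _
  have he : 0 ≤ Real.exp a - 1 := sub_nonneg.2 (Real.one_le_exp ha0)
  -- The next exponential is split as `H + G · 1{X (t+1) = j}` with `G` and `H` functions of the
  -- past, so that conditioning replaces the indicator by the kernel.
  set G : Ω → ℝ := {ω | X t ω = i}.indicator fun ω => Y ω * (c * (Real.exp a - 1)) with hG
  set H : Ω → ℝ := {ω | X t ω = i}.piecewise (fun ω => Y ω * c) Y with hH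
  have hGm : Measurable[history X t] G :=
    Measurable.indicator (m := history X t) (Measurable.mul_const (m := history X t) hYm _) hi
  have hGint : Integrable G μ := (hYint.mul_const _).indicator (hm _ hi)
  have hHint : Integrable H μ := by
    have : H = fun ω => Y ω + {ω | X t ω = i}.indicator (fun ω => Y ω * (c - 1)) ω := by
      funext ω
      by_cases h : X t ω = i <;> (simp [hH, h]; try ring)
    rw [this]
    exact hYint.add ((hYint.mul_const _).indicator (hm _ hi))
  have hGbd : ∀ ω, ‖G ω‖ ≤ Real.exp (a * t) * (c * (Real.exp a - 1)) := by
    intro ω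
    refine (norm_indicator_le_norm_self _ _).trans ?_
    rw [Real.norm_of_nonneg (mul_nonneg (Real.exp_nonneg _) (mul_nonneg hc0 he))]
    refine mul_le_mul_of_nonneg_right ?_ (mul_nonneg hc0 he)
    exact Real.exp_le_exp.2 (mul_le_mul_of_nonneg_left
      (edgeDisc_le P _ t i j (nonneg_of_rowStochastic hP i j)) ha0)
  have hstep : ∀ ω, Real.exp (a * edgeDisc P (fun s => X s ω) (t + 1) i j) =
      H ω + G ω * (if X (t + 1) ω = j then 1 else 0) := by
    intro ω
    rw [edgeDisc_succ]
    by_cases h : X t ω = i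
    · by_cases h' : X (t + 1) ω = j
      · simp only [hH, hG, hY, h, h', if_true, Set.piecewise, Set.indicator, Set.mem_ofPred_eq, c,
          mul_one]
        rw [show ∀ y : ℝ, a * (y + (1 - P i j)) = a * y + -a * P i j + a by intro y; ring,
          Real.exp_add, Real.exp_add]
        ring
      · simp only [hH, hG, hY, h, h', if_true, if_false, Set.piecewise, Set.indicator,
          Set.mem_ofPred_eq, c, mul_zero, add_zero]
        rw [show ∀ y : ℝ, a * (y + (0 - P i j)) = a * y + -a * P i j by intro y; ring,
          Real.exp_add]
    · simp [hH, hG, hY, h]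
  have hind : Measurable fun ω => if X (t + 1) ω = j then (1 : ℝ) else 0 :=
    Measurable.ite (hX.measurable _ (measurableSet_singleton j)) measurable_const measurable_const
  have hGI : Integrable (fun ω => G ω * (if X (t + 1) ω = j then 1 else 0)) μ :=
    hGint.mul_bdd (c := 1) hind.aestronglyMeasurable
      (Eventually.of_forall fun ω => by split_ifs <;> simp)
  have hGQ : Integrable (fun ω => G ω * adaptiveKernel P lam (fun s => X s ω) t i j) μ :=
    hGint.mul_bdd (c := 1)
      ((measurable_adaptiveKernel P lam X t i j).mono hm le_rfl).aestronglyMeasurable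
      (Eventually.of_forall fun ω => by
        rw [Real.norm_of_nonneg (adaptiveKernel_nonneg hP lam _ t i j)]
        exact adaptiveKernel_le_one hP lam _ t i j)
  calc ∫ ω, Real.exp (a * edgeDisc P (fun s => X s ω) (t + 1) i j) ∂μ
      = ∫ ω, H ω ∂μ + ∫ ω, G ω * (if X (t + 1) ω = j then 1 else 0) ∂μ := by
        rw [← integral_add hHint hGI]
        exact integral_congr_ae (Eventually.of_forall hstep)
    _ = ∫ ω, H ω + G ω * adaptiveKernel P lam (fun s => X s ω) t i j ∂μ := by
        rw [hX.integral_transition t i j hGm hGbd (fun ω h => by simp [hG, h]),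
          integral_add hHint hGQ]
    _ ≤ ∫ ω, Y ω + Real.exp (a * (driftLevel P lam a + 1 - P i j)) ∂μ := by
        refine integral_mono (hHint.add hGQ) (hYint.add (integrable_const _)) fun ω => ?_
        by_cases h : X t ω = i
        · have := exp_drift_le hP hlam ha (fun s => X s ω) t hd hj
          simp only [hH, hG, h, Set.piecewise, Set.indicator, Set.mem_ofPred_eq, if_true]
          refine le_trans (le_of_eq ?_) this
          simp only [hY, c]
          ring
        · simpa [hH, hG, h] using Real.exp_nonneg _
    _ = _ := by
        rw [integral_add hYint (integrable_const _)]
        simp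

lemma IsTSAW.integral_exp_edgeDisc_le (hP : P ∈ Matrix.rowStochastic ℝ V) (hlam : 0 < lam)
    (hX : IsTSAW μ P lam X) {a : ℝ} (ha : 1 ≤ a) (t : ℕ) {i j : V}
    (hd : 2 ≤ outDegree P i) (hj : 0 < P i j) :
    ∫ ω, Real.exp (a * edgeDisc P (fun s => X s ω) t i j) ∂μ ≤
      1 + t * Real.exp (a * (driftLevel P lam a + 1 - P i j)) := by
  induction t with
  | zero => simp [edgeDisc, edgeCount, departures]
  | succ t ih =>
    have := hX.integral_exp_edgeDisc_succ_le hP hlam ha t hd hj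
    push_cast
    linarith

lemma IsTSAW.measureReal_edgeDisc_ge_le (hP : P ∈ Matrix.rowStochastic ℝ V) (hlam : 0 < lam)
    (hX : IsTSAW μ P lam X) {a : ℝ} (ha : 1 ≤ a) (t : ℕ) {i j : V}
    (hd : 2 ≤ outDegree P i) (hj : 0 < P i j) (y : ℝ) :
    μ.real {ω | driftLevel P lam a + 1 - pMin P + y / a ≤ edgeDisc P (fun s => X s ω) t i j} ≤
      (t + 1) * Real.exp (-y) := by
  have ha0 : 0 < a := by linarith
  have hp := pMin_pos hd hj
  have hp1 : pMin P ≤ P i j := pMin_le hd hj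
  have hle1 := le_one_of_rowStochastic hP i j
  have hlog : 0 ≤ Real.log (1 / pMin P) :=
    Real.log_nonneg ((one_le_div hp).2 (hp1.trans hle1))
  have hb : 0 ≤ driftLevel P lam a := by unfold driftLevel; positivity
  set B := Real.exp (a * (driftLevel P lam a + 1 - pMin P)) with hB
  -- This absorbs the initial moment `1` into `B`, turning `1 + t B` into `(t + 1) B`.
  have hB1 : 1 ≤ B := Real.one_le_exp (mul_nonneg ha0.le (by linarith))
  have hmono : Real.exp (a * (driftLevel P lam a + 1 - P i j)) ≤ B :=
    Real.exp_le_exp.2 (mul_le_mul_of_nonneg_left (by linarith) ha0.le)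
  have hE : ∫ ω, Real.exp (a * edgeDisc P (fun s => X s ω) t i j) ∂μ ≤ (t + 1) * B := by
    refine (hX.integral_exp_edgeDisc_le hP hlam ha t hd hj).trans ?_
    have := mul_le_mul_of_nonneg_left hmono (Nat.cast_nonneg (α := ℝ) t)
    linarith
  have hmarkov := mul_meas_ge_le_integral_of_nonneg (μ := μ)
    (f := fun ω => Real.exp (a * edgeDisc P (fun s => X s ω) t i j))
    (Eventually.of_forall fun ω => Real.exp_nonneg _)
    (integrable_exp_edgeDisc hP hX.measurable ha0.le t i j) (B * Real.exp y)
  have hset : {ω | driftLevel P lam a + 1 - pMin P + y / a ≤ edgeDisc P (fun s => X s ω) t i j} =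
      {ω | B * Real.exp y ≤ Real.exp (a * edgeDisc P (fun s => X s ω) t i j)} := by
    ext ω
    simp only [Set.mem_ofPred_eq, hB]
    rw [← Real.exp_add, Real.exp_le_exp, ← mul_le_mul_iff_right₀ ha0, mul_add,
      mul_div_cancel₀ _ ha0.ne']
  rw [hset]
  have hpos : 0 < B * Real.exp y := by positivity
  have h := hmarkov.trans hE
  rw [Real.exp_neg, ← div_eq_mul_inv, le_div_iff₀ (Real.exp_pos y)]
  refine le_of_mul_le_mul_left ?_ (lt_of_lt_of_le one_pos hB1)
  linarith

/-- Needed for the case `dMax P = 1`, where the exact value `0` requires the walk to stay on support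
edges. -/
lemma IsTSAW.ae_transition_pos (hP : P ∈ Matrix.rowStochastic ℝ V) (hX : IsTSAW μ P lam X) :
    ∀ᵐ ω ∂μ, ∀ t, 0 < P (X t ω) (X (t + 1) ω) := by
  have key : ∀ (t : ℕ) (i j : V), P i j = 0 → ∀ᵐ ω ∂μ, ¬ (X t ω = i ∧ X (t + 1) ω = j) := by
    intro t i j h0
    have hi : MeasurableSet[history X t] {ω | X t ω = i} := measurableSet_history_eq X le_rfl i
    have hs : MeasurableSet {ω | X t ω = i ∧ X (t + 1) ω = j} :=
      (history_le hX.measurable t _ hi).inter (hX.measurable _ (measurableSet_singleton j))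
    have h := hX.integral_transition t i j
      (G := {ω | X t ω = i}.indicator fun _ => (1 : ℝ)) (C := 1)
      (Measurable.indicator (m := history X t) measurable_const hi)
      (fun ω => (norm_indicator_le_norm_self _ _).trans (by simp)) (fun ω h => by simp [h])
    simp only [adaptiveKernel, h0, zero_mul, zero_div, mul_zero, integral_zero] at h
    have h' : μ.real {ω | X t ω = i ∧ X (t + 1) ω = j} = 0 := by
      rw [← integral_indicator_one hs, ← h]
      refine integral_congr_ae (Eventually.of_forall fun ω => ?_)
      by_cases h1 : X t ω = i <;> by_cases h2 : X (t + 1) ω = j <;> simp [h1, h2]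
    rw [measureReal_eq_zero_iff] at h'
    rw [ae_iff]
    simpa using h'
  have hall : ∀ᵐ ω ∂μ, ∀ (t : ℕ) (i j : V), P i j = 0 → ¬ (X t ω = i ∧ X (t + 1) ω = j) := by
    simp only [ae_all_iff]
    exact key
  filter_upwards [hall] with ω hω t
  refine lt_of_le_of_ne (nonneg_of_rowStochastic hP _ _) fun h => ?_
  exact hω t _ _ h.symm ⟨rfl, rfl⟩

end Walk

/-! ### Asymptotics of `Λ_t` and comparison of thresholds. -/

section Bounds

variable {V : Type*} [Fintype V] [Nonempty V]

lemma exp_neg_bigLambda (δ : ℝ) (t : ℕ) :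
    Real.exp (-bigLambda V δ t) =
      ((Fintype.card V : ℝ) * ((t : ℝ) + 1) * ((t : ℝ) + 2) ^ (1 + δ))⁻¹ := by
  have hV : (0 : ℝ) < Fintype.card V := by exact_mod_cast Fintype.card_pos
  rw [bigLambda, Real.exp_neg, Real.exp_log (by positivity)]

/-- The factor `t + 1` inside `Λ_t` cancels the linear growth of the moment bound, leaving a
summable tail; `|V|` is merely bounded below by `1`. -/
lemma succ_mul_exp_neg_bigLambda_le (δ : ℝ) (t : ℕ) :
    (t + 1) * Real.exp (-bigLambda V δ t) ≤ (((t + 2 : ℕ) : ℝ) ^ (1 + δ))⁻¹ := by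
  have hV : (1 : ℝ) ≤ Fintype.card V := by exact_mod_cast Fintype.card_pos
  have ht : (0 : ℝ) < (t : ℝ) + 1 := by positivity
  have hr : (0 : ℝ) < ((t : ℝ) + 2) ^ (1 + δ) := by positivity
  rw [exp_neg_bigLambda, ← div_eq_mul_inv, div_le_iff₀ (by positivity)]
  push_cast
  rw [show ∀ u v w : ℝ, u⁻¹ * (v * w * u) = v * w * (u⁻¹ * u) by intros; ring,
    inv_mul_cancel₀ hr.ne']
  nlinarith

lemma tendsto_bigLambda {δ : ℝ} (hδ : 0 < δ) : Tendsto (bigLambda V δ) atTop atTop := by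
  have hV : (1 : ℝ) ≤ Fintype.card V := by exact_mod_cast Fintype.card_pos
  refine tendsto_atTop_mono (fun t => ?_)
    (Real.tendsto_log_atTop.comp tendsto_natCast_atTop_atTop)
  -- At `t = 0` the comparison `log t ≤ Λ_t` relies on the convention `Real.log 0 = 0`.
  rcases Nat.eq_zero_or_pos t with rfl | ht
  · simp only [Function.comp, Nat.cast_zero, Real.log_zero, bigLambda]
    refine Real.log_nonneg ?_
    have : (1 : ℝ) ≤ (0 + 2) ^ (1 + δ) := Real.one_le_rpow (by norm_num) (by linarith)
    nlinarith
  · have ht' : (0 : ℝ) < t := by exact_mod_cast ht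
    refine Real.log_le_log ht' ?_
    have : (1 : ℝ) ≤ ((t : ℝ) + 2) ^ (1 + δ) := Real.one_le_rpow (by linarith) (by linarith)
    calc (t : ℝ) ≤ 1 * (t + 1) * 1 := by linarith
      _ ≤ _ := by gcongr

/-- Once `λ Λ_t ≥ 1`, both `α_t / λ` and `Λ_t / α_t` equal `√(Λ_t / λ)`. Only one of the two copies
of `log (1/pMin) / λ` in `C1` is used; the other terms of its bracket and `C0 / α_t` are nonnegative
slack. -/
lemma threshold_le [DecidableEq V] {P : Matrix V V ℝ} (hP : P ∈ Matrix.rowStochastic ℝ V)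
    {lam δ : ℝ} (hlam : 0 < lam)
    {i j : V} (hd : 2 ≤ outDegree P i) (hj : 0 < P i j) {t : ℕ} (ht : 1 ≤ lam * bigLambda V δ t) :
    driftLevel P lam (alpha V lam δ t) + 1 - pMin P + bigLambda V δ t / alpha V lam δ t ≤
      C1 P lam + 2 * Real.sqrt (bigLambda V δ t / lam) + C0 P / alpha V lam δ t := by
  have hp := pMin_pos hd hj
  have hlog : 0 ≤ Real.log (1 / pMin P) :=
    Real.log_nonneg ((one_le_div hp).2 ((pMin_le hd hj).trans (le_one_of_rowStochastic hP i j)))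
  set L := bigLambda V δ t
  have hL : 0 < L := by
    by_contra! h
    nlinarith
  have hα : alpha V lam δ t = Real.sqrt (lam * L) := max_eq_right (Real.one_le_sqrt.2 ht)
  have hα0 : 0 < alpha V lam δ t := lt_max_of_lt_left one_pos
  have hsl := Real.sq_sqrt hlam.le
  have hsL := Real.sq_sqrt hL.le
  have hsl0 := Real.sqrt_pos.2 hlam
  have hsL0 := Real.sqrt_pos.2 hL
  have h1 : alpha V lam δ t / lam = Real.sqrt (L / lam) := by
    rw [hα, Real.sqrt_mul hlam.le, Real.sqrt_div hL.le, div_eq_div_iff hlam.ne' hsl0.ne']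
    nlinarith
  have h2 : L / alpha V lam δ t = Real.sqrt (L / lam) := by
    rw [hα, Real.sqrt_mul hlam.le, Real.sqrt_div hL.le, div_eq_div_iff (by positivity) hsl0.ne']
    nlinarith
  have h3 : 0 ≤ C0 P / alpha V lam δ t :=
    div_nonneg (Real.log_nonneg (le_add_of_nonneg_right (by positivity))) hα0.le
  have h4 : 0 ≤ 1 / lam * (Real.log (dMax P) + lam + Real.log 2 + Real.log (1 / pMin P)) := by
    have := Real.log_natCast_nonneg (dMax P)
    have := Real.log_nonneg (one_le_two (α := ℝ))
    positivity
  have h5 : driftLevel P lam (alpha V lam δ t) =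
      alpha V lam δ t / lam + 1 / lam * Real.log (1 / pMin P) := by
    unfold driftLevel; ring
  rw [h5, h1, h2, C1]
  linarith

end Bounds

/-! ### Borel–Cantelli and the maximum over edges. -/

section Main

variable {V : Type*} [Fintype V] [DecidableEq V] [Nonempty V]
  [MeasurableSpace V] [MeasurableSingletonClass V]
  {Ω : Type*} [MeasurableSpace Ω] {μ : Measure Ω} [IsProbabilityMeasure μ]
  {P : Matrix V V ℝ} {lam : ℝ} {X : ℕ → Ω → V}

lemma nonempty_support (hP : P ∈ Matrix.rowStochastic ℝ V) :
    Nonempty {e : V × V // 0 < P e.1 e.2} := by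
  obtain ⟨i⟩ := ‹Nonempty V›
  obtain ⟨j, hj⟩ := exists_pos_of_rowStochastic hP i
  exact ⟨⟨(i, j), hj⟩⟩

lemma IsTSAW.maxDisc_eq_zero (hP : P ∈ Matrix.rowStochastic ℝ V) (hX : IsTSAW μ P lam X)
    (hd : dMax P = 1) : ∀ᵐ ω ∂μ, ∀ t : ℕ, maxDisc P (fun s => X s ω) t = 0 := by
  have := nonempty_support hP
  have hdeg (i : V) : outDegree P i ≤ 1 := hd ▸ Finset.le_sup (Finset.mem_univ i)
  filter_upwards [hX.ae_transition_pos hP] with ω hω t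
  have h : ∀ e : {e : V × V // 0 < P e.1 e.2},
      edgeDisc P (fun s => X s ω) t e.1.1 e.1.2 = 0 := by
    rintro ⟨⟨i, j⟩, hj⟩
    dsimp only at hj ⊢
    have h1 := eq_one_of_outDegree_le_one hP (hdeg i) hj
    induction t with
    | zero => simp [edgeDisc, edgeCount, departures]
    | succ t ih =>
      rw [edgeDisc_succ, ih, h1]
      by_cases hi : X t ω = i
      · have hj' : X (t + 1) ω = j := by
          by_contra hne
          have := hω t
          rw [hi, eq_zero_of_outDegree_le_one hP (hdeg i) hj hne] at this
          exact lt_irrefl _ this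
        simp [hi, hj']
      · simp [hi]
  simp only [maxDisc, h, ciSup_const]

lemma IsTSAW.eventually_edgeDisc_le (hP : P ∈ Matrix.rowStochastic ℝ V) (hlam : 0 < lam)
    (hX : IsTSAW μ P lam X) {δ : ℝ} (hδ : 0 < δ) {i j : V}
    (hd : 2 ≤ outDegree P i) (hj : 0 < P i j) :
    ∀ᵐ ω ∂μ, ∀ᶠ t : ℕ in atTop, edgeDisc P (fun s => X s ω) t i j ≤
      driftLevel P lam (alpha V lam δ t) + 1 - pMin P + bigLambda V δ t / alpha V lam δ t := by
  set A : ℕ → Set Ω := fun t => {ω | driftLevel P lam (alpha V lam δ t) + 1 - pMin P +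
    bigLambda V δ t / alpha V lam δ t ≤ edgeDisc P (fun s => X s ω) t i j}
  have hbound (t : ℕ) : μ.real (A t) ≤ (((t + 2 : ℕ) : ℝ) ^ (1 + δ))⁻¹ :=
    (hX.measureReal_edgeDisc_ge_le hP hlam (le_max_left _ _) t hd hj _).trans
      (succ_mul_exp_neg_bigLambda_le δ t)
  have hsum : Summable fun t => μ.real (A t) :=
    Summable.of_nonneg_of_le (fun _ => measureReal_nonneg) hbound
      ((summable_nat_add_iff 2).2 (Real.summable_nat_rpow_inv.2 (by linarith : 1 < 1 + δ)))
  have hfin : ∑' t, μ (A t) ≠ ⊤ := by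
    have := hsum.tsum_ofReal_ne_top
    simpa using this
  filter_upwards [ae_eventually_notMem hfin] with ω hω
  filter_upwards [hω] with t ht
  exact (not_le.1 ht).le

lemma IsTSAW.eventually_maxDisc_le (hP : P ∈ Matrix.rowStochastic ℝ V) (hlam : 0 < lam)
    (hX : IsTSAW μ P lam X) (hd : dMax P ≠ 1) {δ : ℝ} (hδ : 0 < δ) :
    ∀ᵐ ω ∂μ, ∀ᶠ t : ℕ in atTop, maxDisc P (fun s => X s ω) t ≤
      C1 P lam + 2 * Real.sqrt (bigLambda V δ t / lam) + C0 P / alpha V lam δ t := by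
  have := nonempty_support hP
  obtain ⟨i₀, hi₀⟩ : ∃ i, 2 ≤ outDegree P i := by
    by_contra! h
    obtain ⟨i⟩ := ‹Nonempty V›
    refine hd (le_antisymm (Finset.sup_le fun i _ => Nat.lt_succ_iff.1 (h i)) ?_)
    exact (one_le_outDegree hP i).trans (Finset.le_sup (Finset.mem_univ i))
  obtain ⟨j₀, hj₀⟩ := exists_pos_of_rowStochastic hP i₀
  have hp := pMin_pos hi₀ hj₀
  have hp1 := (pMin_le hi₀ hj₀).trans (le_one_of_rowStochastic hP i₀ j₀)
  have hlog : 0 ≤ Real.log (1 / pMin P) := Real.log_nonneg ((one_le_div hp).2 hp1)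
  have hC0 : 0 ≤ C0 P := Real.log_nonneg (le_add_of_nonneg_right (by positivity))
  have hC1 : 0 ≤ C1 P lam := by
    have := Real.log_natCast_nonneg (dMax P)
    have := Real.log_nonneg (one_le_two (α := ℝ))
    exact add_nonneg (by linarith) (by positivity)
  have hall : ∀ᵐ ω ∂μ, ∀ i j, 2 ≤ outDegree P i → 0 < P i j → ∀ᶠ t : ℕ in atTop,
      edgeDisc P (fun s => X s ω) t i j ≤ driftLevel P lam (alpha V lam δ t) + 1 - pMin P +
        bigLambda V δ t / alpha V lam δ t := by
    simp only [ae_all_iff]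
    exact fun i j hi hj => hX.eventually_edgeDisc_le hP hlam hδ hi hj
  filter_upwards [hall] with ω hω
  have hedge : ∀ e : {e : V × V // 0 < P e.1 e.2}, ∀ᶠ t : ℕ in atTop,
      edgeDisc P (fun s => X s ω) t e.1.1 e.1.2 ≤
        C1 P lam + 2 * Real.sqrt (bigLambda V δ t / lam) + C0 P / alpha V lam δ t := by
    rintro ⟨⟨i, j⟩, hj⟩
    dsimp only at hj ⊢
    by_cases hi : 2 ≤ outDegree P i
    · filter_upwards [hω i j hi hj,
        ((tendsto_bigLambda (V := V) hδ).const_mul_atTop hlam).eventually_ge_atTop 1] with t h1 h2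
      exact h1.trans (threshold_le hP hlam hi hj h2)
    -- In a row of out-degree one `P i j = 1`, so the discrepancy is a count minus a larger count,
    -- while the bound is nonnegative.
    · refine Eventually.of_forall fun t => ?_
      have hα0 : 0 < alpha V lam δ t := lt_max_of_lt_left one_pos
      have h0 : edgeDisc P (fun s => X s ω) t i j ≤ 0 := by
        rw [edgeDisc, eq_one_of_outDegree_le_one hP (by omega) hj, mul_one, sub_nonpos]
        exact_mod_cast edgeCount_le_departures _ t i j
      exact h0.trans (by positivity)
  filter_upwards [eventually_all.2 hedge] with t ht
  exact ciSup_le ht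

end Main

end TSAW

theorem mainTheorem4 {V : Type*} [Fintype V] [DecidableEq V] [Nonempty V]
    [MeasurableSpace V] [MeasurableSingletonClass V]
    {Ω : Type*} [MeasurableSpace Ω] (μ : Measure Ω) [IsProbabilityMeasure μ]
    (P : Matrix V V ℝ) (hP : P ∈ Matrix.rowStochastic ℝ V)
    (lam : ℝ) (hlam : 0 < lam)
    (X : ℕ → Ω → V) (hX : TSAW.IsTSAW μ P lam X) :
    (TSAW.dMax P = 1 → ∀ᵐ ω ∂μ, ∀ t : ℕ, TSAW.maxDisc P (fun s => X s ω) t = 0) ∧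
    (TSAW.dMax P ≠ 1 → ∀ δ : ℝ, 0 < δ → ∀ᵐ ω ∂μ, ∀ᶠ t : ℕ in atTop,
      TSAW.maxDisc P (fun s => X s ω) t ≤
        TSAW.C1 P lam + 2 * Real.sqrt (TSAW.bigLambda V δ t / lam)
          + TSAW.C0 P / TSAW.alpha V lam δ t) :=
  ⟨hX.maxDisc_eq_zero hP, fun hd _ hδ => hX.eventually_maxDisc_le hP hlam hd hδ⟩
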